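/- Let $d\ge 1$ and let $\Phi:M_d\to M_d$ be a quantum channel, i.e. a completely positive trace-preserving linear map on the complex $d\times d$ matrices. For a density matrix $\rho$ let $S(\rho)=-\operatorname{Tr}\rho\log\rho$, and for density matrices $\rho,\omega$ let $H(\rho,\omega)=\operatorname{Tr}\rho(\log\rho-\log\omega)$ if $\ker\omega\subseteq\ker\rho$, and $H(\rho,\omega)=+\infty$ otherwise. The Holevo capacity of a channel $\Theta$ is $$C_{\rm Holv}(\Theta)=\sup_{\{\pi_j,\rho_j\}}\Big(S\big[\Theta\big(\textstyle\sum_j\pi_j\rho_j\big)\big]-\sum_j\pi_j\,S[\Theta(\rho_j)]\Big),$$ where the supremum is over all finite ensembles of pure input states $\rho_j=|\psi_j\rangle\langle\psi_j|$ with probabilities $\pi_j$. An optimal average input of $\Phi$ is a density matrix $\rho_{\rm Av}=\sum_j\pi_j\rho_j$ that is the average of an ensemble attaining the supremum in $C_{\rm Holv}(\Phi)$. Then $\Phi$ has an optimal average input, and for every optimal average input $\rho_{\rm Av}$ of $\Phi$, $$C_{\rm Holv}(\Phi\otimes\Phi)>2\,C_{\rm Holv}(\Phi)$$ if and only if there exists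 a unit vector $|\Psi\rangle\in\mathbf C^d\otimes\mathbf C^d$ such that $$H\big[(\Phi\otimes\Phi)(|\Psi\rangle\langle\Psi|),\,(\Phi\otimes\Phi)(\rho_{\rm Av}\otimes\rho_{\rm Av})\big]>2\,C_{\rm Holv}(\Phi).$$ -/

import Mathlib

open scoped Kronecker ComplexOrder

namespace QuantumChannel

noncomputable section

variable {α β γ δ : Type} [Fintype α] [DecidableEq α] [Fintype β] [DecidableEq β]
  [Fintype γ] [DecidableEq γ] [Fintype δ] [DecidableEq δ]

/-- The tensor product `Φ ⊗ Ψ` of linear maps between matrix algebras, where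
`M_α ⊗ M_γ` is identified with the matrices indexed by `α × γ` through the Kronecker product. -/
def tensorMap (Φ : Matrix α α ℂ →ₗ[ℂ] Matrix β β ℂ) (Ψ : Matrix γ γ ℂ →ₗ[ℂ] Matrix δ δ ℂ) :
    Matrix (α × γ) (α × γ) ℂ →ₗ[ℂ] Matrix (β × δ) (β × δ) ℂ :=
  (kroneckerLinearEquiv β β δ δ ℂ).toLinearMap ∘ₗ TensorProduct.map Φ Ψ ∘ₗ
    (kroneckerLinearEquiv α α γ γ ℂ).symm.toLinearMap

theorem tensorMap_kronecker (Φ : Matrix α α ℂ →ₗ[ℂ] Matrix β β ℂ)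
    (Ψ : Matrix γ γ ℂ →ₗ[ℂ] Matrix δ δ ℂ) (A : Matrix α α ℂ) (B : Matrix γ γ ℂ) :
    tensorMap Φ Ψ (A ⊗ₖ B) = Φ A ⊗ₖ Ψ B := by
  simp [tensorMap]

/-- A quantum channel: a completely positive, trace-preserving linear map. Complete positivity
means that `Φ ⊗ id` maps positive semidefinite matrices over `M_k` to such matrices, for all `k`. -/
structure IsChannel (Φ : Matrix α α ℂ →ₗ[ℂ] Matrix β β ℂ) : Prop where
  completely_positive : ∀ (k : ℕ) (M : Matrix (α × Fin k) (α × Fin k) ℂ), M.PosSemidef →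
    (tensorMap Φ (LinearMap.id : Matrix (Fin k) (Fin k) ℂ →ₗ[ℂ] Matrix (Fin k) (Fin k) ℂ)
      M).PosSemidef
  trace_preserving : ∀ A : Matrix α α ℂ, (Φ A).trace = A.trace

/-- `|ψ⟩⟨ψ|`. -/
def proj (ψ : α → ℂ) : Matrix α α ℂ := Matrix.vecMulVec ψ (star ψ)

/-- The logarithm of a Hermitian matrix, by functional calculus. The eigenvalue `0` is sent to
`Real.log 0 = 0`, in accordance with the convention `0 log 0 = 0` in the entropies below. -/
def matrixLog (ρ : Matrix α α ℂ) : Matrix α α ℂ := cfc Real.log ρ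

/-- The von Neumann entropy `S(ρ) = - Tr ρ log ρ`. -/
def entropy (ρ : Matrix α α ℂ) : ℝ := -(ρ * matrixLog ρ).trace.re

open scoped Classical in
/-- The relative entropy `H(ρ, ω) = Tr ρ (log ρ - log ω)` when `ker ω ⊆ ker ρ`, and `+∞`
otherwise. -/
def relEntropy (ρ ω : Matrix α α ℂ) : EReal :=
  if ∀ v : α → ℂ, ω.mulVec v = 0 → ρ.mulVec v = 0 then
    (((ρ * (matrixLog ρ - matrixLog ω)).trace.re : ℝ) : EReal)
  else ⊤

/-- A finite ensemble `{π_j, |ψ_j⟩⟨ψ_j|}` of pure states. -/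
structure PureEnsemble (α : Type) [Fintype α] where
  size : ℕ
  weight : Fin size → ℝ
  vec : Fin size → α → ℂ
  weight_nonneg : ∀ j, 0 ≤ weight j
  weight_sum : ∑ j, weight j = 1
  vec_unit : ∀ j, star (vec j) ⬝ᵥ vec j = 1

/-- The average `ρ_Av = ∑ j, π_j |ψ_j⟩⟨ψ_j|` of an ensemble. -/
def PureEnsemble.average (E : PureEnsemble α) : Matrix α α ℂ :=
  ∑ j, (E.weight j : ℂ) • proj (E.vec j)

/-- The Holevo quantity `χ({π_j, Φ(ρ_j)}) = S(Φ(ρ_Av)) - ∑ j, π_j S(Φ(ρ_j))` of the output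
ensemble. -/
def holevoChi (Φ : Matrix α α ℂ →ₗ[ℂ] Matrix β β ℂ) (E : PureEnsemble α) : ℝ :=
  entropy (Φ E.average) - ∑ j, E.weight j * entropy (Φ (proj (E.vec j)))

/-- The Holevo capacity: the supremum of the Holevo quantity over all finite ensembles of pure
input states. -/
def holevoCapacity (Φ : Matrix α α ℂ →ₗ[ℂ] Matrix β β ℂ) : EReal :=
  ⨆ E : PureEnsemble α, (holevoChi Φ E : EReal)

/-- `ρ` is the average of an ensemble that attains the supremum in the Holevo capacity. -/
def IsOptimalAverageInput (Φ : Matrix α α ℂ →ₗ[ℂ] Matrix β β ℂ) (ρ : Matrix α α ℂ) : Prop :=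
  ∃ E : PureEnsemble α, (holevoChi Φ E : EReal) = holevoCapacity Φ ∧ E.average = ρ

end

end QuantumChannel

/-! The capacity is a minimax distance: the output of an optimal average is the centre of a
relative-entropy ball of radius the capacity containing every pure-state output, and around any
other centre some output is at least that far away. Both halves come from Donald's identity
`sum_weight_mul_relEntropyReal`. Klein's inequality turns it into a lower bound on the distance of
some ensemble member from any centre (`exists_holevoChi_le_relEntropy`). Conversely, mixing a pure
state with small weight `t` into an optimal ensemble cannot raise the Holevo quantity; dividing by
`t` and letting `t → 0` bounds its distance to the centre (`relEntropy_le_of_isMax`).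

Both are applied to `Φ ⊗ Φ` with centre the output of `ρAv ⊗ ρAv`. Entropy is additive on products,
so the product of two optimal ensembles has Holevo quantity `2C`, where `C` is the capacity of `Φ`.
If the capacity of `Φ ⊗ Φ` exceeds `2C`, a better ensemble has a member further than `2C` from this
centre; if not, the product ensemble is optimal and no pure output is further than `2C`. Existence
of an optimal ensemble is a compactness argument. -/

namespace QuantumChannel

noncomputable section

variable {α β γ δ : Type} [Fintype α] [DecidableEq α] [Fintype β] [DecidableEq β]
  [Fintype γ] [DecidableEq γ] [Fintype δ] [DecidableEq δ]

set_option linter.unusedSectionVars false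

open Matrix Filter Topology

/-! ### Compactness of convex hulls and of the set of unit vectors. -/

section Compactness

/-- In a finite-dimensional space the convex hull of a compact set is compact. -/
theorem isCompact_convexHull_of_finiteDimensional {E : Type*} [AddCommGroup E] [Module ℝ E]
    [TopologicalSpace E] [ContinuousAdd E] [ContinuousSMul ℝ E] [FiniteDimensional ℝ E]
    {K : Set E} (hK : IsCompact K) : IsCompact (convexHull ℝ K) := by
  -- Carathéodory: `finrank + 1` points suffice, so the hull is a finite union of continuous images
  -- of compact sets.
  have key : convexHull ℝ K = ⋃ k ∈ Finset.range (Module.finrank ℝ E + 2),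
      (fun p : (Fin k → ℝ) × (Fin k → E) => ∑ i, p.1 i • p.2 i) ''
        (stdSimplex ℝ (Fin k) ×ˢ Set.univ.pi fun _ => K) := by
    apply Set.Subset.antisymm
    · intro x hx
      obtain ⟨ι, _, z, w, hz, hind, hw, hw1, hx⟩ := eq_pos_convex_span_of_mem_convexHull hx
      have hcard := hind.card_le_finrank_succ
      have hle : Module.finrank ℝ (vectorSpan ℝ (Set.range z)) ≤ Module.finrank ℝ E :=
        Submodule.finrank_le _
      let e := (Fintype.equivFin ι).symm
      refine Set.mem_iUnion₂.2 ⟨Fintype.card ι, Finset.mem_range.2 (by omega), ?_⟩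
      refine ⟨(w ∘ e, z ∘ e), ⟨⟨fun i => (hw _).le, ?_⟩, fun i _ => hz ⟨_, rfl⟩⟩, ?_⟩
      · rw [← hw1]; exact e.sum_comp w
      · rw [← hx]; exact e.sum_comp fun i => w i • z i
    · intro x hx
      obtain ⟨k, -, ⟨w, z⟩, ⟨hw, hz⟩, rfl⟩ := Set.mem_iUnion₂.1 hx
      exact (convex_convexHull ℝ K).sum_mem (fun i _ => hw.1 i) hw.2
        fun i _ => subset_convexHull ℝ K (hz i trivial)
  rw [key]
  refine (Finset.range _).isCompact_biUnion fun k _ => ?_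
  refine ((isCompact_stdSimplex ℝ (Fin k)).prod (isCompact_univ_pi fun _ => hK)).image ?_
  fun_prop

theorem isCompact_unitVectors : IsCompact {v : α → ℂ | star v ⬝ᵥ v = 1} := by
  refine (isCompact_univ_pi fun _ : α => isCompact_closedBall (0 : ℂ) 1).of_isClosed_subset ?_ ?_
  · refine isClosed_eq ?_ continuous_const
    simp only [dotProduct]
    fun_prop
  · intro v hv i _
    have h : ∑ j, ‖v j‖ ^ 2 = 1 := by
      have := congrArg Complex.re (show star v ⬝ᵥ v = 1 from hv)
      simpa [dotProduct, ← Complex.normSq_eq_conj_mul_self, Complex.normSq_eq_norm_sq,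
        ← Complex.ofReal_pow] using this
    have h2 : ‖v i‖ ^ 2 ≤ 1 := h ▸ Finset.single_le_sum (f := fun j => ‖v j‖ ^ 2)
      (fun j _ => by positivity) (Finset.mem_univ i)
    simpa using (sq_le_one_iff₀ (norm_nonneg _)).1 h2

end Compactness

/-! ### Functional calculus in a diagonalization, and continuity of the entropy. -/

section FunctionalCalculus

/-- The algebra homomorphism `a ↦ U diag(a) U⋆`. -/
def conjDiagonal (U : unitaryGroup α ℂ) : (α → ℝ) →ₐ[ℝ] Matrix α α ℂ where
  toFun a := (U : Matrix α α ℂ) * diagonal (fun i => (a i : ℂ)) * star (U : Matrix α α ℂ)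
  map_one' := by simp
  map_mul' a b := by
    simp [Matrix.mul_assoc, ← Matrix.mul_assoc (star (U : Matrix α α ℂ)),
      ← Matrix.mul_assoc (diagonal _) (diagonal _)]
  map_zero' := by simp
  map_add' a b := by
    simp only [Pi.add_apply, Complex.ofReal_add, ← diagonal_add, Matrix.mul_add, Matrix.add_mul]
  commutes' r := by
    have : diagonal (fun i => (((algebraMap ℝ (α → ℝ)) r i : ℝ) : ℂ)) =
        algebraMap ℝ (Matrix α α ℂ) r := by
      ext i j; simp [Matrix.algebraMap_eq_diagonal, diagonal]
    rw [this, ← Algebra.commutes, Matrix.mul_assoc]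
    simp

theorem conjDiagonal_apply (U : unitaryGroup α ℂ) (a : α → ℝ) : conjDiagonal U a =
    (U : Matrix α α ℂ) * diagonal (fun i => (a i : ℂ)) * star (U : Matrix α α ℂ) := rfl

theorem isHermitian_conjDiagonal (U : unitaryGroup α ℂ) (a : α → ℝ) :
    (conjDiagonal U a).IsHermitian := by
  rw [conjDiagonal_apply, star_eq_conjTranspose]
  refine isHermitian_mul_mul_conjTranspose _ ?_
  rw [IsHermitian, diagonal_conjTranspose]
  congr 1; ext i; simp

/-- The spectrum lies in the finite range of `a`, where any `f`, continuous or not, agrees with its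
Lagrange interpolant; polynomials commute with algebra homomorphisms. -/
theorem cfc_conjDiagonal (U : unitaryGroup α ℂ) (a : α → ℝ) (f : ℝ → ℝ) :
    cfc f (conjDiagonal U a) = conjDiagonal U (f ∘ a) := by
  let p := Lagrange.interpolate (Finset.univ.image a) id f
  have hp : ∀ i, p.eval (a i) = f (a i) := fun i =>
    Lagrange.eval_interpolate_at_node f (Set.injOn_id _)
      (Finset.mem_image_of_mem a (Finset.mem_univ i))
  have hspec : spectrum ℝ (conjDiagonal U a) ⊆ Set.range a := by
    refine (AlgHom.spectrum_apply_subset (conjDiagonal U) a).trans ?_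
    intro r hr
    by_contra h
    apply hr
    rw [spectrum.mem_resolventSet_iff, Pi.isUnit_iff]
    intro i
    have : r - a i ≠ 0 := fun h' => h ⟨i, (sub_eq_zero.1 h').symm⟩
    simpa using this
  have h1 : cfc f (conjDiagonal U a) = cfc p.eval (conjDiagonal U a) := by
    apply cfc_congr
    intro x hx
    obtain ⟨i, rfl⟩ := hspec hx
    exact (hp i).symm
  rw [h1, cfc_polynomial p _ (isHermitian_conjDiagonal U a).isSelfAdjoint,
    Polynomial.aeval_algHom_apply]
  congr 1
  ext i
  rw [Polynomial.aeval_pi_apply₂]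
  simpa using hp i

theorem conjDiagonal_eigenvalues {A : Matrix α α ℂ} (hA : A.IsHermitian) :
    conjDiagonal hA.eigenvectorUnitary hA.eigenvalues = A := by
  conv_rhs => rw [hA.spectral_theorem]
  rfl

theorem continuousOn_cfc_isHermitian {f : ℝ → ℝ} (hf : Continuous f) :
    ContinuousOn (fun A : Matrix α α ℂ => cfc f A) {A | A.IsHermitian} := by
  open scoped Matrix.Norms.L2Operator in
  exact ContinuousOn.cfc_of_mem_nhdsSet (s := Set.univ) f (by simp) continuousOn_id
    (fun x hx => hx) hf.continuousOn

/-- Unlike `Real.log`, the function `x * Real.log x` is continuous at `0`; this makes the entropy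
continuous up to singular states. -/
theorem mul_matrixLog {A : Matrix α α ℂ} (hA : A.IsHermitian) :
    A * matrixLog A = cfc (fun x => x * Real.log x) A := by
  rw [← conjDiagonal_eigenvalues hA, matrixLog, cfc_conjDiagonal, cfc_conjDiagonal, ← map_mul]
  rfl

theorem continuousOn_entropy :
    ContinuousOn (entropy : Matrix α α ℂ → ℝ) {A | A.IsHermitian} := by
  have h : ContinuousOn (fun A : Matrix α α ℂ => -(cfc (fun x => x * Real.log x) A).trace.re)
      {A | A.IsHermitian} := by
    have h1 := continuousOn_cfc_isHermitian (α := α) Real.continuous_mul_log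
    have h2 : Continuous fun A : Matrix α α ℂ => -A.trace.re := by
      have : Continuous fun A : Matrix α α ℂ => A.trace := continuous_id.matrix_trace
      fun_prop
    exact h2.comp_continuousOn h1
  exact h.congr fun A hA => by rw [entropy, mul_matrixLog hA]

end FunctionalCalculus

/-! ### Klein's inequality, kernels, and semicontinuity of the relative entropy. -/

section RelativeEntropy

theorem matrixLog_conjDiagonal (U : unitaryGroup α ℂ) (a : α → ℝ) :
    matrixLog (conjDiagonal U a) = conjDiagonal U fun i => Real.log (a i) :=
  cfc_conjDiagonal U a Real.log

theorem re_trace_mul_conjDiagonal (σ : Matrix α α ℂ) (U : unitaryGroup α ℂ) (a : α → ℝ) :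
    (σ * conjDiagonal U a).trace.re =
      ∑ i, a i * ((star (U : Matrix α α ℂ) * σ * (U : Matrix α α ℂ)) i i).re := by
  have : (σ * conjDiagonal U a).trace =
      (star (U : Matrix α α ℂ) * σ * (U : Matrix α α ℂ) * diagonal fun i => (a i : ℂ)).trace := by
    rw [conjDiagonal_apply, ← Matrix.mul_assoc, trace_mul_comm]
    simp only [Matrix.mul_assoc]
  rw [this, trace, Complex.re_sum]
  refine Finset.sum_congr rfl fun i _ => ?_
  rw [diag_apply, mul_diagonal, Complex.re_mul_ofReal, mul_comm]

theorem re_trace_conjDiagonal (U : unitaryGroup α ℂ) (a : α → ℝ) :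
    (conjDiagonal U a).trace.re = ∑ i, a i := by
  have := re_trace_mul_conjDiagonal 1 U a
  simpa using this

/-- The entropy in terms of a diagonalization. -/
theorem entropy_conjDiagonal (U : unitaryGroup α ℂ) (a : α → ℝ) :
    entropy (conjDiagonal U a) = ∑ i, Real.negMulLog (a i) := by
  rw [entropy, matrixLog_conjDiagonal, ← map_mul, re_trace_conjDiagonal, ← Finset.sum_neg_distrib]
  refine Finset.sum_congr rfl fun i _ => ?_
  simp [Real.negMulLog]

/-- The finite expression `Tr ρ (log ρ - log ω)`. -/
def relEntropyReal (ρ ω : Matrix α α ℂ) : ℝ := (ρ * (matrixLog ρ - matrixLog ω)).trace.re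

theorem relEntropyReal_eq (ρ ω : Matrix α α ℂ) :
    relEntropyReal ρ ω = -entropy ρ - (ρ * matrixLog ω).trace.re := by
  simp [relEntropyReal, entropy, Matrix.mul_sub]

theorem _root_.Matrix.PosSemidef.diag_re_nonneg {S : Matrix α α ℂ} (hS : S.PosSemidef) (j : α) :
    0 ≤ (S j j).re := (Complex.le_def.1 (hS.diag_nonneg (i := j))).1

theorem _root_.Matrix.PosSemidef.mulVec_single_eq_zero {S : Matrix α α ℂ} (hS : S.PosSemidef)
    {j : α}
    (hj : (S j j).re = 0) : S *ᵥ Pi.single j 1 = 0 := by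
  rw [← hS.dotProduct_mulVec_zero_iff]
  have him := (Complex.le_def.1 (hS.diag_nonneg (i := j))).2
  have h0 : S j j = 0 := Complex.ext hj him.symm
  simp [h0]

theorem _root_.Matrix.PosSemidef.unitary_conj {S : Matrix α α ℂ} (hS : S.PosSemidef)
    (U : unitaryGroup α ℂ) :
    (star (U : Matrix α α ℂ) * S * (U : Matrix α α ℂ)).PosSemidef :=
  hS.conjTranspose_mul_mul_same _

theorem conjDiagonal_mulVec_col (U : unitaryGroup α ℂ) (a : α → ℝ) (j : α) :
    conjDiagonal U a *ᵥ ((U : Matrix α α ℂ) *ᵥ Pi.single j 1) =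
      (a j : ℂ) • ((U : Matrix α α ℂ) *ᵥ Pi.single j 1) := by
  rw [mulVec_mulVec, conjDiagonal_apply, Matrix.mul_assoc, UnitaryGroup.star_mul_self,
    Matrix.mul_one, ← mulVec_mulVec, ← mulVec_smul]
  congr 1
  ext i
  by_cases h : i = j
  · subst h; simp
  · simp [h]

theorem _root_.Matrix.PosSemidef.mulVec_eq_zero_of_add {A B : Matrix α α ℂ} (hA : A.PosSemidef)
    (hB : B.PosSemidef) {v : α → ℂ} (h : (A + B) *ᵥ v = 0) : B *ᵥ v = 0 := by
  rw [← hB.dotProduct_mulVec_zero_iff]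
  have h1 := hA.dotProduct_mulVec_nonneg v
  have h2 := hB.dotProduct_mulVec_nonneg v
  have h3 : star v ⬝ᵥ A *ᵥ v + star v ⬝ᵥ B *ᵥ v = 0 := by
    rw [← dotProduct_add, ← add_mulVec, h, dotProduct_zero]
  exact ((add_eq_zero_iff_of_nonneg h1 h2).1 h3).2

/-- The weights of `σ` vanish on the kernel of `ω` when `ker ω ⊆ ker σ`. -/
theorem diag_eq_zero_of_ker_le {σ : Matrix α α ℂ} {U : unitaryGroup α ℂ} {a : α → ℝ}
    (hker : ∀ v, conjDiagonal U a *ᵥ v = 0 → σ *ᵥ v = 0) {j : α} (hj : a j = 0) :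
    (star (U : Matrix α α ℂ) * σ * (U : Matrix α α ℂ)) j j = 0 := by
  have h := hker _ (by rw [conjDiagonal_mulVec_col, hj]; simp)
  have h2 : (star (U : Matrix α α ℂ) * σ * (U : Matrix α α ℂ)) *ᵥ Pi.single j 1 = 0 := by
    rw [← mulVec_mulVec, ← mulVec_mulVec, h, mulVec_zero]
  simpa using congrFun h2 j

/-- A zero diagonal entry of a positive semidefinite matrix puts the basis vector in its kernel, and
a vector killed by `conjDiagonal U a` is supported on the eigenvectors with `a j = 0`. -/
theorem ker_le_of_diag_eq_zero {σ : Matrix α α ℂ} (hσ : σ.PosSemidef) {U : unitaryGroup α ℂ}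
    {a : α → ℝ}
    (h : ∀ j, a j = 0 → ((star (U : Matrix α α ℂ) * σ * (U : Matrix α α ℂ)) j j).re = 0)
    (v : α → ℂ) (hv : conjDiagonal U a *ᵥ v = 0) : σ *ᵥ v = 0 := by
  set c := star (U : Matrix α α ℂ) *ᵥ v with hc
  have hac : ∀ j, (a j : ℂ) * c j = 0 := by
    intro j
    have : star (U : Matrix α α ℂ) *ᵥ (conjDiagonal U a *ᵥ v) = 0 := by rw [hv, mulVec_zero]
    rw [conjDiagonal_apply, mulVec_mulVec, ← Matrix.mul_assoc, ← Matrix.mul_assoc,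
      UnitaryGroup.star_mul_self, Matrix.one_mul, ← mulVec_mulVec] at this
    simpa [mulVec_diagonal] using congrFun this j
  set S := star (U : Matrix α α ℂ) * σ * (U : Matrix α α ℂ) with hS
  have hSc : S *ᵥ c = 0 := by
    have hcs : c = ∑ j, c j • (Pi.single j 1 : α → ℂ) := by
      ext i; simp [Finset.sum_apply, Pi.single_apply]
    rw [hcs, mulVec_sum]
    refine Finset.sum_eq_zero fun j _ => ?_
    rw [mulVec_smul]
    rcases mul_eq_zero.1 (hac j) with h0 | h0
    · rw [(hσ.unitary_conj U).mulVec_single_eq_zero (h j (by exact_mod_cast h0)),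
        smul_zero]
    · rw [h0, zero_smul]
  have hU : (U : Matrix α α ℂ) * star (U : Matrix α α ℂ) = 1 := (mem_unitaryGroup_iff).1 U.2
  have hfin : σ *ᵥ v = (U : Matrix α α ℂ) *ᵥ (S *ᵥ c) := by
    rw [hc, hS, mulVec_mulVec, mulVec_mulVec]
    congr 1
    simp only [Matrix.mul_assoc, hU, Matrix.mul_one]
    rw [← Matrix.mul_assoc, hU, Matrix.one_mul]
  rw [hfin, hSc, mulVec_zero]

theorem sum_normSq_row (U : unitaryGroup α ℂ) (j : α) :
    ∑ i, Complex.normSq ((U : Matrix α α ℂ) j i) = 1 := by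
  have h := congrFun (congrFun ((mem_unitaryGroup_iff).1 U.2) j) j
  rw [mul_apply] at h
  have h2 := congrArg Complex.re h
  simpa [star_apply, Complex.mul_conj] using h2

theorem sum_normSq_col (U : unitaryGroup α ℂ) (i : α) :
    ∑ j, Complex.normSq ((U : Matrix α α ℂ) j i) = 1 := by
  have h := congrFun (congrFun ((mem_unitaryGroup_iff').1 U.2) i) i
  rw [mul_apply] at h
  have h2 := congrArg Complex.re h
  simpa [star_apply, ← Complex.normSq_eq_conj_mul_self] using h2

/-- The weights are the squared moduli of the entries of a unitary, hence doubly stochastic; this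
reduces Klein's inequality to scalars. -/
theorem diag_conj_conjDiagonal (U V : unitaryGroup α ℂ) (r : α → ℝ) (j : α) :
    ((star (V : Matrix α α ℂ) * conjDiagonal U r * (V : Matrix α α ℂ)) j j).re =
      ∑ i, Complex.normSq (((star V * U : unitaryGroup α ℂ) : Matrix α α ℂ) j i) * r i := by
  have : star (V : Matrix α α ℂ) * conjDiagonal U r * (V : Matrix α α ℂ) =
      ((star V * U : unitaryGroup α ℂ) : Matrix α α ℂ) * diagonal (fun i => (r i : ℂ)) *
        star ((star V * U : unitaryGroup α ℂ) : Matrix α α ℂ) := by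
    simp [conjDiagonal_apply, Matrix.mul_assoc]
  rw [this, mul_apply, Complex.re_sum]
  refine Finset.sum_congr rfl fun i _ => ?_
  rw [mul_diagonal, star_apply, mul_right_comm, Complex.star_def, Complex.mul_conj,
    ← Complex.ofReal_mul, Complex.ofReal_re]

/-- **Klein's inequality.** -/
theorem relEntropyReal_nonneg {ρ ω : Matrix α α ℂ} (hρ : ρ.PosSemidef) (hω : ω.PosSemidef)
    (htr : ρ.trace = ω.trace) (hker : ∀ v, ω *ᵥ v = 0 → ρ *ᵥ v = 0) :
    0 ≤ relEntropyReal ρ ω := by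
  obtain ⟨U, r, hr, rfl⟩ : ∃ (U : unitaryGroup α ℂ) (r : α → ℝ), (∀ i, 0 ≤ r i) ∧
      conjDiagonal U r = ρ := ⟨_, _, hρ.eigenvalues_nonneg, conjDiagonal_eigenvalues hρ.1⟩
  obtain ⟨V, w, hw, rfl⟩ : ∃ (V : unitaryGroup α ℂ) (w : α → ℝ), (∀ i, 0 ≤ w i) ∧
      conjDiagonal V w = ω := ⟨_, _, hω.eigenvalues_nonneg, conjDiagonal_eigenvalues hω.1⟩
  set P : α → α → ℝ := fun j i =>
    Complex.normSq (((star V * U : unitaryGroup α ℂ) : Matrix α α ℂ) j i) with hP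
  have hP0 : ∀ j i, 0 ≤ P j i := fun j i => Complex.normSq_nonneg _
  have hrow : ∀ j, ∑ i, P j i = 1 := sum_normSq_row _
  have hcol : ∀ i, ∑ j, P j i = 1 := sum_normSq_col _
  have htr' : ∑ i, r i = ∑ j, w j := by
    rw [← re_trace_conjDiagonal U, ← re_trace_conjDiagonal V, htr]
  have hzero : ∀ j, w j = 0 → ∀ i, P j i * r i = 0 := by
    intro j hj
    have h := congrArg Complex.re (diag_eq_zero_of_ker_le hker hj)
    rw [diag_conj_conjDiagonal, Complex.zero_re,
      Finset.sum_eq_zero_iff_of_nonneg fun i _ => mul_nonneg (hP0 j i) (hr i)] at h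
    exact fun i => h i (Finset.mem_univ i)
  -- This is `x - 1 ≤ x log x` at `x = r i / w j`, scaled by `w j`; if `w j = 0` both sides vanish.
  -- Summed over `i` and `j`, the left side is zero by double stochasticity and equality of traces.
  have hterm : ∀ j i, P j i * (r i - w j) ≤
      P j i * (r i * Real.log (r i)) - Real.log (w j) * (P j i * r i) := by
    intro j i
    rcases (hw j).eq_or_lt with hj | hj
    · have := hzero j hj.symm i
      rw [← hj, mul_sub, this, ← mul_assoc, this]
      simp
    · have hb : w j * (r i / w j - 1) ≤ w j * (r i / w j * Real.log (r i / w j)) :=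
        mul_le_mul_of_nonneg_left (Real.self_sub_one_le_mul_log (div_nonneg (hr i) hj.le)) hj.le
      have hl : w j * (r i / w j - 1) = r i - w j := by field_simp
      have hrt : w j * (r i / w j * Real.log (r i / w j)) =
          r i * Real.log (r i) - Real.log (w j) * r i := by
        rcases (hr i).eq_or_lt with hi | hi
        · simp [← hi]
        · rw [Real.log_div hi.ne' hj.ne']; field_simp
      rw [hl, hrt] at hb
      calc _ ≤ P j i * (r i * Real.log (r i) - Real.log (w j) * r i) :=
            mul_le_mul_of_nonneg_left hb (hP0 j i)
        _ = _ := by ring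
  have hsum := Finset.sum_le_sum fun j (_ : j ∈ Finset.univ) =>
    Finset.sum_le_sum fun i (_ : i ∈ Finset.univ) => hterm j i
  have hl : ∑ j, ∑ i, P j i * (r i - w j) = 0 := by
    simp only [mul_sub, Finset.sum_sub_distrib, ← Finset.sum_mul, hrow, one_mul]
    rw [Finset.sum_comm]
    simp only [← Finset.sum_mul, hcol, one_mul]
    rw [htr', sub_self]
  have hr' : ∑ j, ∑ i, (P j i * (r i * Real.log (r i)) - Real.log (w j) * (P j i * r i)) =
      relEntropyReal (conjDiagonal U r) (conjDiagonal V w) := by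
    rw [relEntropyReal_eq, entropy_conjDiagonal, matrixLog_conjDiagonal, re_trace_mul_conjDiagonal]
    simp only [diag_conj_conjDiagonal, Finset.sum_sub_distrib, ← Finset.mul_sum]
    rw [Finset.sum_comm]
    simp only [← Finset.sum_mul, hcol, one_mul, ← Finset.sum_neg_distrib]
    simp [Real.negMulLog, hP]
  linarith

/-- A logarithm shifted by `ε`, continuous on the line. -/
def shiftedLog (ε x : ℝ) : ℝ := Real.log (|x| + ε)

theorem continuous_shiftedLog {ε : ℝ} (hε : 0 < ε) : Continuous (shiftedLog ε) := by
  unfold shiftedLog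
  exact (continuous_abs.add continuous_const).log fun x =>
    (add_pos_of_nonneg_of_pos (abs_nonneg x) hε).ne'

theorem re_trace_mul_cfc {σ ω : Matrix α α ℂ} (hω : ω.IsHermitian) (f : ℝ → ℝ) :
    (σ * cfc f ω).trace.re = ∑ i, f (hω.eigenvalues i) *
      ((star (hω.eigenvectorUnitary : Matrix α α ℂ) * σ *
        (hω.eigenvectorUnitary : Matrix α α ℂ)) i i).re := by
  conv_lhs => rw [← conjDiagonal_eigenvalues hω, cfc_conjDiagonal, re_trace_mul_conjDiagonal]
  rfl

/-- The kernel condition is essential: the convention `Real.log 0 = 0` breaks monotonicity at zero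
eigenvalues, but there `σ` has no weight. -/
theorem re_trace_mul_matrixLog_le {σ ω : Matrix α α ℂ} (hσ : σ.PosSemidef) (hω : ω.PosSemidef)
    (hker : ∀ v, ω *ᵥ v = 0 → σ *ᵥ v = 0) {ε : ℝ} (hε : 0 < ε) :
    (σ * matrixLog ω).trace.re ≤ (σ * cfc (shiftedLog ε) ω).trace.re := by
  rw [matrixLog, re_trace_mul_cfc hω.1, re_trace_mul_cfc hω.1]
  refine Finset.sum_le_sum fun i _ => ?_
  rcases (hω.eigenvalues_nonneg i).eq_or_lt with hi | hi
  · rw [← conjDiagonal_eigenvalues hω.1] at hker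
    rw [diag_eq_zero_of_ker_le hker hi.symm]
    simp
  · refine mul_le_mul_of_nonneg_right ?_ ((hσ.unitary_conj _).diag_re_nonneg i)
    rw [shiftedLog, abs_of_pos hi]
    exact Real.log_le_log hi (by linarith)

/-- If the shifted logarithms give a lower bound, so does the logarithm, and the kernels are
nested. -/
theorem ker_le_and_le_of_forall_shiftedLog {σ ω : Matrix α α ℂ} (hσ : σ.PosSemidef)
    (hω : ω.PosSemidef) {B : ℝ}
    (h : ∀ ε > 0, B ≤ (σ * cfc (shiftedLog ε) ω).trace.re) :
    (∀ v, ω *ᵥ v = 0 → σ *ᵥ v = 0) ∧ B ≤ (σ * matrixLog ω).trace.re := by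
  simp only [matrixLog, re_trace_mul_cfc hω.1] at h ⊢
  set a := hω.1.eigenvalues with ha
  set q : α → ℝ := fun i => ((star (hω.1.eigenvectorUnitary : Matrix α α ℂ) * σ *
        (hω.1.eigenvectorUnitary : Matrix α α ℂ)) i i).re with hq
  have ha0 : ∀ i, 0 ≤ a i := hω.eigenvalues_nonneg
  have hq0 : ∀ i, 0 ≤ q i := (hσ.unitary_conj _).diag_re_nonneg
  have hzero : ∀ j, a j = 0 → q j = 0 := by
    intro j hj
    by_contra hne
    have hpos : 0 < q j := lt_of_le_of_ne (hq0 j) (Ne.symm hne)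
    -- Weight of `σ` on a null eigenvector of `ω` contributes `q j * log ε`, which tends to `-∞`,
    -- while `ε < 1` bounds the other terms uniformly.
    have hbound : ∀ ε ∈ Set.Ioo (0 : ℝ) 1,
        B ≤ q j * Real.log ε + ∑ i ∈ Finset.univ.erase j, Real.log (a i + 1) * q i := by
      intro ε hε
      refine (h ε hε.1).trans ?_
      rw [← Finset.add_sum_erase _ _ (Finset.mem_univ j)]
      refine add_le_add (le_of_eq ?_) (Finset.sum_le_sum fun i _ => ?_)
      · simp [shiftedLog, hj, mul_comm, hq]
      · refine mul_le_mul_of_nonneg_right ?_ (hq0 i)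
        rw [shiftedLog, abs_of_nonneg (ha0 i)]
        exact Real.log_le_log (add_pos_of_nonneg_of_pos (ha0 i) hε.1) (by linarith [hε.2])
    have hlim : Tendsto (fun ε => q j * Real.log ε +
        ∑ i ∈ Finset.univ.erase j, Real.log (a i + 1) * q i) (𝓝[>] 0) atBot :=
      tendsto_atBot_add_const_right _ _ (Real.tendsto_log_nhdsGT_zero.const_mul_atBot hpos)
    obtain ⟨ε, h1, h2⟩ := ((hlim.eventually (eventually_lt_atBot B)).and
      (Ioo_mem_nhdsGT (zero_lt_one' ℝ))).exists
    exact (hbound ε h2).not_gt h1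
  constructor
  · have := ker_le_of_diag_eq_zero hσ (U := hω.1.eigenvectorUnitary) (a := a) hzero
    rwa [conjDiagonal_eigenvalues hω.1] at this
  · have hlim : Tendsto (fun ε => ∑ i, shiftedLog ε (a i) * q i) (𝓝[>] 0)
        (𝓝 (∑ i, Real.log (a i) * q i)) := by
      refine tendsto_finsetSum _ fun i _ => ?_
      rcases (ha0 i).eq_or_lt with hi | hi
      · simp [hzero i hi.symm]
      · refine Tendsto.mul_const _ (Tendsto.mono_left ?_ nhdsWithin_le_nhds)
        have hc : ContinuousAt (fun ε : ℝ => Real.log (|a i| + ε)) 0 :=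
          ContinuousAt.log (by fun_prop) (by simpa using hi.ne')
        simpa [shiftedLog, abs_of_pos hi] using hc.tendsto
    refine ge_of_tendsto hlim ?_
    filter_upwards [self_mem_nhdsWithin] with ε hε using h ε hε

/-- Lower semicontinuity of the relative entropy along the segment from `ω` to `σ`. -/
theorem ker_le_and_relEntropyReal_le {σ ω : Matrix α α ℂ} (hσ : σ.PosSemidef)
    (hω : ω.PosSemidef) {C : ℝ}
    (h : ∀ t ∈ Set.Ioo (0 : ℝ) 1, relEntropyReal σ ((1 - t) • ω + t • σ) ≤ C) :
    (∀ v, ω *ᵥ v = 0 → σ *ᵥ v = 0) ∧ relEntropyReal σ ω ≤ C := by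
  suffices (∀ v, ω *ᵥ v = 0 → σ *ᵥ v = 0) ∧
      -entropy σ - C ≤ (σ * matrixLog ω).trace.re by
    refine ⟨this.1, ?_⟩
    rw [relEntropyReal_eq]
    linarith [this.2]
  -- The order of limits matters: for fixed `ε` the shifted logarithm is continuous, so `t → 0` is
  -- taken first and `ε → 0` afterwards.
  refine ker_le_and_le_of_forall_shiftedLog hσ hω fun ε hε => ?_
  have hpsd : ∀ t ∈ Set.Icc (0 : ℝ) 1, ((1 - t) • ω + t • σ).PosSemidef := fun t ht =>
    (hω.smul (by linarith [ht.2])).add (hσ.smul ht.1)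
  have hcont : ContinuousOn
      (fun t : ℝ => (σ * cfc (shiftedLog ε) ((1 - t) • ω + t • σ)).trace.re) (Set.Icc 0 1) := by
    have h1 : ContinuousOn (fun t : ℝ => cfc (shiftedLog ε) ((1 - t) • ω + t • σ))
        (Set.Icc 0 1) :=
      (continuousOn_cfc_isHermitian (continuous_shiftedLog hε)).comp
        (f := fun t : ℝ => (1 - t) • ω + t • σ)
        (Continuous.continuousOn (by fun_prop)) fun t ht => (hpsd t ht).1
    have h2 : Continuous fun A : Matrix α α ℂ => (σ * A).trace.re :=
      Complex.continuous_re.comp (continuous_const.matrix_mul continuous_id).matrix_trace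
    exact h2.comp_continuousOn h1
  have hlim := (hcont 0 (by simp)).mono_left (nhdsWithin_mono 0 Set.Ioo_subset_Icc_self)
  rw [nhdsWithin_Ioo_eq_nhdsGT zero_lt_one] at hlim
  simp only [sub_zero, one_smul, zero_smul, add_zero] at hlim
  refine ge_of_tendsto hlim ?_
  filter_upwards [Ioo_mem_nhdsGT (zero_lt_one' ℝ)] with t ht
  have h1 := h t ht
  have hker : ∀ v, ((1 - t) • ω + t • σ) *ᵥ v = 0 → σ *ᵥ v = 0 := by
    intro v hv
    have := (hω.smul (α := ℝ) (a := 1 - t) (by linarith [ht.2])).mulVec_eq_zero_of_add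
      (hσ.smul (α := ℝ) (a := t) ht.1.le) hv
    rw [smul_mulVec] at this
    exact (smul_eq_zero.1 this).resolve_left ht.1.ne'
  have h2 := re_trace_mul_matrixLog_le hσ (hpsd t (Set.Ioo_subset_Icc_self ht)) hker hε
  rw [relEntropyReal_eq] at h1
  linarith

end RelativeEntropy

/-! ### Donald's identity, the minimax property and existence of optimal ensembles. -/

section Ensembles

/-- A positive trace-preserving map. -/
structure IsPositiveTP (Φ : Matrix α α ℂ →ₗ[ℂ] Matrix β β ℂ) : Prop where
  posSemidef : ∀ M : Matrix α α ℂ, M.PosSemidef → (Φ M).PosSemidef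
  trace_preserving : ∀ M : Matrix α α ℂ, (Φ M).trace = M.trace

theorem posSemidef_proj (ψ : α → ℂ) : (proj ψ).PosSemidef := posSemidef_vecMulVec_self_star ψ

theorem trace_proj {ψ : α → ℂ} (h : star ψ ⬝ᵥ ψ = 1) : (proj ψ).trace = 1 := by
  rw [proj, trace_vecMulVec, dotProduct_comm, h]

theorem PureEnsemble.posSemidef_average (E : PureEnsemble α) : E.average.PosSemidef :=
  posSemidef_sum _ fun j _ => (posSemidef_proj _).smul (by exact_mod_cast E.weight_nonneg j)

theorem PureEnsemble.trace_average (E : PureEnsemble α) : E.average.trace = 1 := by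
  simp only [average, trace_sum, trace_smul, trace_proj (E.vec_unit _), smul_eq_mul, mul_one]
  exact_mod_cast E.weight_sum

theorem PureEnsemble.map_average (Φ : Matrix α α ℂ →ₗ[ℂ] Matrix β β ℂ) (E : PureEnsemble α) :
    Φ E.average = ∑ j, (E.weight j : ℂ) • Φ (proj (E.vec j)) := by
  simp [average]

/-- The ensemble with weights and vectors indexed by an arbitrary finite type. -/
def PureEnsemble.ofFintype {ι : Type*} [Fintype ι] (w : ι → ℝ) (v : ι → α → ℂ)
    (hw : ∀ i, 0 ≤ w i) (hw1 : ∑ i, w i = 1) (hv : ∀ i, star (v i) ⬝ᵥ v i = 1) :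
    PureEnsemble α where
  size := Fintype.card ι
  weight j := w ((Fintype.equivFin ι).symm j)
  vec j := v ((Fintype.equivFin ι).symm j)
  weight_nonneg _ := hw _
  weight_sum := by rw [← hw1]; exact (Fintype.equivFin ι).symm.sum_comp w
  vec_unit _ := hv _

theorem PureEnsemble.average_ofFintype {ι : Type*} [Fintype ι] (w : ι → ℝ) (v : ι → α → ℂ)
    (hw : ∀ i, 0 ≤ w i) (hw1 : ∑ i, w i = 1) (hv : ∀ i, star (v i) ⬝ᵥ v i = 1) :
    (ofFintype w v hw hw1 hv).average = ∑ i, (w i : ℂ) • proj (v i) :=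
  (Fintype.equivFin ι).symm.sum_comp fun i => (w i : ℂ) • proj (v i)

theorem holevoChi_ofFintype {ι : Type*} [Fintype ι] (Φ : Matrix α α ℂ →ₗ[ℂ] Matrix β β ℂ)
    (w : ι → ℝ) (v : ι → α → ℂ)
    (hw : ∀ i, 0 ≤ w i) (hw1 : ∑ i, w i = 1) (hv : ∀ i, star (v i) ⬝ᵥ v i = 1) :
    holevoChi Φ (PureEnsemble.ofFintype w v hw hw1 hv) =
      entropy (Φ (∑ i, (w i : ℂ) • proj (v i))) - ∑ i, w i * entropy (Φ (proj (v i))) := by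
  rw [holevoChi, PureEnsemble.average_ofFintype]
  congr 1
  exact (Fintype.equivFin ι).symm.sum_comp fun i => w i * entropy (Φ (proj (v i)))

theorem re_trace_map_average_mul (Φ : Matrix α α ℂ →ₗ[ℂ] Matrix β β ℂ) (E : PureEnsemble α)
    (L : Matrix β β ℂ) : (Φ E.average * L).trace.re =
      ∑ j, E.weight j * (Φ (proj (E.vec j)) * L).trace.re := by
  simp [E.map_average, Finset.sum_mul, trace_sum, trace_smul]

/-- **Donald's identity.** -/
theorem sum_weight_mul_relEntropyReal (Φ : Matrix α α ℂ →ₗ[ℂ] Matrix β β ℂ) (E : PureEnsemble α)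
    (ω : Matrix β β ℂ) : ∑ j, E.weight j * relEntropyReal (Φ (proj (E.vec j))) ω =
      holevoChi Φ E + relEntropyReal (Φ E.average) ω := by
  -- The term `Tr σ log ω` is linear in `σ`, so it averages exactly; as an identity of real
  -- expressions this needs no kernel condition.
  simp only [relEntropyReal_eq, holevoChi, re_trace_map_average_mul, mul_sub, mul_neg,
    Finset.sum_sub_distrib, Finset.sum_neg_distrib]
  ring

/-- Mixing a pure state into an ensemble. -/
def PureEnsemble.mix (E : PureEnsemble α) (ψ : α → ℂ) (hψ : star ψ ⬝ᵥ ψ = 1) (t : ℝ)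
    (ht : t ∈ Set.Icc (0 : ℝ) 1) : PureEnsemble α :=
  ofFintype (ι := Option (Fin E.size)) (fun i => i.elim t fun j => (1 - t) * E.weight j)
    (fun i => i.elim ψ E.vec)
    (by rintro (_ | j); exacts [ht.1, mul_nonneg (by linarith [ht.2]) (E.weight_nonneg j)])
    (by simp [Fintype.sum_option, ← Finset.mul_sum, E.weight_sum])
    (by rintro (_ | j); exacts [hψ, E.vec_unit j])

theorem PureEnsemble.average_mix (E : PureEnsemble α) (ψ : α → ℂ) (hψ : star ψ ⬝ᵥ ψ = 1) (t : ℝ)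
    (ht : t ∈ Set.Icc (0 : ℝ) 1) :
    (E.mix ψ hψ t ht).average = ((1 - t : ℝ) : ℂ) • E.average + (t : ℂ) • proj ψ := by
  rw [mix, average_ofFintype, Fintype.sum_option, add_comm]
  simp only [average, Finset.smul_sum, smul_smul, Complex.ofReal_mul, Option.elim]

/-- The Holevo quantity of the mixture is the mean distance of its members to their own average
output; the share of `E` is then rewritten by Donald's identity. -/
theorem holevoChi_mix (Φ : Matrix α α ℂ →ₗ[ℂ] Matrix β β ℂ) (E : PureEnsemble α) (ψ : α → ℂ)
    (hψ : star ψ ⬝ᵥ ψ = 1) (t : ℝ) (ht : t ∈ Set.Icc (0 : ℝ) 1) :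
    holevoChi Φ (E.mix ψ hψ t ht) =
      (1 - t) * (holevoChi Φ E + relEntropyReal (Φ E.average) (Φ (E.mix ψ hψ t ht).average)) +
        t * relEntropyReal (Φ (proj ψ)) (Φ (E.mix ψ hψ t ht).average) := by
  rw [← sum_weight_mul_relEntropyReal]
  set ω := Φ (E.mix ψ hψ t ht).average with hω
  have h1 : Φ (E.mix ψ hψ t ht).average =
      ((1 - t : ℝ) : ℂ) • ∑ j, (E.weight j : ℂ) • Φ (proj (E.vec j)) + (t : ℂ) • Φ (proj ψ) := by
    rw [PureEnsemble.average_mix, map_add, map_smul, map_smul, E.map_average]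
  have h2 : ∀ L, (ω * L).trace.re =
      (1 - t) * ∑ j, E.weight j * (Φ (proj (E.vec j)) * L).trace.re +
        t * (Φ (proj ψ) * L).trace.re := by
    intro L
    rw [hω, h1, Matrix.add_mul, trace_add, Complex.add_re, smul_mul, smul_mul, trace_smul, trace_smul,
      smul_eq_mul, smul_eq_mul, Complex.re_ofReal_mul, Complex.re_ofReal_mul, ← E.map_average,
      re_trace_map_average_mul]
  have h3 : holevoChi Φ (E.mix ψ hψ t ht) = entropy ω -
      (t * entropy (Φ (proj ψ)) + (1 - t) * ∑ j, E.weight j * entropy (Φ (proj (E.vec j)))) := by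
    rw [hω, holevoChi]
    congr 1
    refine ((Fintype.equivFin (Option (Fin E.size))).symm.sum_comp fun i =>
      (i.elim t fun j => (1 - t) * E.weight j) *
        entropy (Φ (proj (i.elim ψ E.vec)))).trans ?_
    simp [Fintype.sum_option, Finset.mul_sum, mul_assoc]
  rw [h3, entropy, h2]
  simp only [relEntropyReal_eq, mul_sub, mul_neg, Finset.sum_sub_distrib, Finset.sum_neg_distrib]
  ring

/-- The outputs of pure states lie within the capacity of the output of an optimal average. -/
theorem relEntropy_le_of_isMax {Φ : Matrix α α ℂ →ₗ[ℂ] Matrix β β ℂ} (hΦ : IsPositiveTP Φ)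
    {E : PureEnsemble α} (hE : ∀ F : PureEnsemble α, holevoChi Φ F ≤ holevoChi Φ E) {ψ : α → ℂ}
    (hψ : star ψ ⬝ᵥ ψ = 1) :
    relEntropy (Φ (proj ψ)) (Φ E.average) ≤ (holevoChi Φ E : EReal) := by
  have hσ := hΦ.posSemidef _ (posSemidef_proj ψ)
  have hω := hΦ.posSemidef _ E.posSemidef_average
  obtain ⟨hker, hle⟩ := ker_le_and_relEntropyReal_le hσ hω (C := holevoChi Φ E) (by
    intro t ht
    have hIcc := Set.Ioo_subset_Icc_self ht
    have havg : Φ (E.mix ψ hψ t hIcc).average = t • Φ (proj ψ) + (1 - t) • Φ E.average := by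
      rw [PureEnsemble.average_mix, map_add, map_smul, map_smul, Complex.coe_smul,
        Complex.coe_smul, add_comm]
    have hnn : 0 ≤ relEntropyReal (Φ E.average) (Φ (E.mix ψ hψ t hIcc).average) := by
      refine relEntropyReal_nonneg hω (hΦ.posSemidef _ (PureEnsemble.posSemidef_average _)) ?_ ?_
      · rw [hΦ.trace_preserving, hΦ.trace_preserving, PureEnsemble.trace_average,
          PureEnsemble.trace_average]
      · intro v hv
        rw [havg] at hv
        have ht' : 0 < 1 - t := by linarith [ht.2]
        have := (hσ.smul (α := ℝ) (a := t) ht.1.le).mulVec_eq_zero_of_add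
          (hω.smul (α := ℝ) (a := 1 - t) ht'.le) hv
        rw [smul_mulVec] at this
        exact (smul_eq_zero.1 this).resolve_left ht'.ne'
    have hmix := holevoChi_mix Φ E ψ hψ t hIcc
    have hmax := hE (E.mix ψ hψ t hIcc)
    rw [add_comm, ← havg]
    -- Optimality bounds `holevoChi_mix` by `holevoChi Φ E`; dropping the nonnegative term `hnn` and
    -- cancelling `t > 0` leaves the claim.
    nlinarith [mul_nonneg (show 0 ≤ 1 - t by linarith [ht.2]) hnn, ht.1])
  rw [relEntropy, if_pos hker]
  exact_mod_cast hle

/-- Some member of an ensemble is at least as far from any state as the Holevo quantity. -/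
theorem exists_holevoChi_le_relEntropy {Φ : Matrix α α ℂ →ₗ[ℂ] Matrix β β ℂ}
    (hΦ : IsPositiveTP Φ) (E : PureEnsemble α) {ω : Matrix β β ℂ} (hω : ω.PosSemidef)
    (hω1 : ω.trace = 1) :
    ∃ j, (holevoChi Φ E : EReal) ≤ relEntropy (Φ (proj (E.vec j))) ω := by
  by_cases hker : ∀ j, ∀ v : β → ℂ, ω *ᵥ v = 0 → Φ (proj (E.vec j)) *ᵥ v = 0
  · have hnn : 0 ≤ relEntropyReal (Φ E.average) ω := by
      refine relEntropyReal_nonneg (hΦ.posSemidef _ E.posSemidef_average) hω ?_ fun v hv => ?_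
      · rw [hΦ.trace_preserving, E.trace_average, hω1]
      · simp [E.map_average, sum_mulVec, smul_mulVec, hker _ v hv]
    by_contra! hlt
    have hlt' : ∀ j, relEntropyReal (Φ (proj (E.vec j))) ω < holevoChi Φ E := by
      intro j
      have := hlt j
      rw [relEntropy, if_pos (hker j)] at this
      exact_mod_cast this
    have hsum := sum_weight_mul_relEntropyReal Φ E ω
    have : ∑ j, E.weight j * relEntropyReal (Φ (proj (E.vec j))) ω <
        ∑ j, E.weight j * holevoChi Φ E := by
      refine Finset.sum_lt_sum
        (fun j _ => mul_le_mul_of_nonneg_left (hlt' j).le (E.weight_nonneg j)) ?_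
      -- Weights may vanish, so strictness of the sum needs a member of positive weight, which
      -- exists because they sum to `1`.
      obtain ⟨j, -, hj⟩ := Finset.exists_lt_of_sum_lt (s := Finset.univ) (f := fun _ => (0 : ℝ))
        (g := E.weight) (by simp [E.weight_sum])
      exact ⟨j, Finset.mem_univ j, mul_lt_mul_of_pos_left (hlt' j) hj⟩
    rw [← Finset.sum_mul, E.weight_sum] at this
    linarith
  · obtain ⟨j, hj⟩ := not_forall.1 hker
    exact ⟨j, by rw [relEntropy, if_neg hj]; exact le_top⟩

/-- The Holevo quantity attains its supremum. -/
theorem exists_isMax_holevoChi [Nonempty α] {Φ : Matrix α α ℂ →ₗ[ℂ] Matrix β β ℂ}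
    (hΦ : IsPositiveTP Φ) :
    ∃ E : PureEnsemble α, ∀ F : PureEnsemble α, holevoChi Φ F ≤ holevoChi Φ E := by
  -- Ensemble sizes are unbounded, but the Holevo quantity depends only on the barycentre of the
  -- points `g v`. It is thus a continuous function on the compact convex hull of their set.
  have hΦc : Continuous Φ := LinearMap.continuous_of_finiteDimensional Φ
  set g : (α → ℂ) → Matrix α α ℂ × ℝ := fun v => (proj v, entropy (Φ (proj v))) with hg
  have hproj : Continuous (proj : (α → ℂ) → Matrix α α ℂ) :=
    continuous_id.matrix_vecMulVec continuous_star
  have hgc : Continuous g := by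
    refine hproj.prodMk (continuousOn_entropy.comp_continuous (hΦc.comp hproj) fun v => ?_)
    exact (hΦ.posSemidef _ (posSemidef_proj v)).1
  set K := g '' {v : α → ℂ | star v ⬝ᵥ v = 1} with hK
  have hKc : IsCompact (convexHull ℝ K) :=
    isCompact_convexHull_of_finiteDimensional (isCompact_unitVectors.image hgc)
  have hfun : ContinuousOn (fun p : Matrix α α ℂ × ℝ => entropy (Φ p.1) - p.2)
      (convexHull ℝ K) := by
    refine ContinuousOn.sub ?_ continuous_snd.continuousOn
    refine continuousOn_entropy.comp (f := fun p : Matrix α α ℂ × ℝ => Φ p.1)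
      (hΦc.comp continuous_fst).continuousOn fun p hp => ?_
    refine (hΦ.posSemidef _ (?_ : p.1.PosSemidef)).1
    obtain ⟨ι, _, w, z, hw, -, hz, rfl⟩ := mem_convexHull_iff_exists_fintype.1 hp
    rw [Prod.fst_sum]
    refine posSemidef_sum _ fun i _ => ?_
    obtain ⟨v, -, hv⟩ := hz i
    rw [← hv]
    exact (posSemidef_proj v).smul (hw i)
  have hmem : ∀ F : PureEnsemble α,
      (F.average, ∑ j, F.weight j * entropy (Φ (proj (F.vec j)))) ∈ convexHull ℝ K := by
    intro F
    refine mem_convexHull_of_exists_fintype F.weight (fun j => g (F.vec j)) F.weight_nonneg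
      F.weight_sum (fun j => ⟨_, F.vec_unit j, rfl⟩) ?_
    ext1
    · simp [Prod.fst_sum, PureEnsemble.average, hg]
    · simp [Prod.snd_sum, hg]
  have hne : (convexHull ℝ K).Nonempty := by
    obtain ⟨i⟩ := ‹Nonempty α›
    exact Set.Nonempty.convexHull ⟨_, Pi.single i 1, by simp, rfl⟩
  obtain ⟨p, hp, hmax⟩ := hKc.exists_isMaxOn hne hfun
  obtain ⟨ι, _, w, z, hw, hw1, hz, rfl⟩ := mem_convexHull_iff_exists_fintype.1 hp
  choose v hv hvz using hz
  refine ⟨PureEnsemble.ofFintype w v hw hw1 hv, fun F => ?_⟩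
  have := hmax (hmem F)
  rw [holevoChi_ofFintype]
  simpa [holevoChi, Prod.fst_sum, Prod.snd_sum, ← hvz, hg] using this

theorem holevoCapacity_eq_of_isMax {Φ : Matrix α α ℂ →ₗ[ℂ] Matrix β β ℂ} {E : PureEnsemble α}
    (hE : ∀ F : PureEnsemble α, holevoChi Φ F ≤ holevoChi Φ E) :
    (holevoChi Φ E : EReal) = holevoCapacity Φ :=
  le_antisymm (le_iSup (fun F => (holevoChi Φ F : EReal)) E)
    (iSup_le fun F => by exact_mod_cast hE F)

end Ensembles

/-! ### Tensor products of channels, states and ensembles. -/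

section TensorProduct

theorem kronecker_linearMap_ext {M : Type*} [AddCommMonoid M] [Module ℂ M]
    {F G : Matrix (α × γ) (α × γ) ℂ →ₗ[ℂ] M}
    (h : ∀ (A : Matrix α α ℂ) (B : Matrix γ γ ℂ), F (A ⊗ₖ B) = G (A ⊗ₖ B)) : F = G := by
  have : F ∘ₗ (kroneckerLinearEquiv α α γ γ ℂ).toLinearMap =
      G ∘ₗ (kroneckerLinearEquiv α α γ γ ℂ).toLinearMap :=
    TensorProduct.ext' fun A B => by simpa using h A B
  ext1 X
  obtain ⟨Y, rfl⟩ := (kroneckerLinearEquiv α α γ γ ℂ).surjective X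
  exact LinearMap.congr_fun this Y

theorem IsChannel.isPositiveTP {Φ : Matrix α α ℂ →ₗ[ℂ] Matrix β β ℂ} (hΦ : IsChannel Φ) :
    IsPositiveTP Φ where
  posSemidef M hM := by
    have h := hΦ.completely_positive 1 (M ⊗ₖ 1) (hM.kronecker PosSemidef.one)
    rw [tensorMap_kronecker] at h
    have h2 := h.submatrix fun i : β => (i, (0 : Fin 1))
    convert h2 using 1
    ext i j
    simp
  trace_preserving := hΦ.trace_preserving

theorem IsChannel.tensorMap_self {d : ℕ}
    {Φ : Matrix (Fin d) (Fin d) ℂ →ₗ[ℂ] Matrix (Fin d) (Fin d) ℂ} (hΦ : IsChannel Φ) :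
    IsPositiveTP (tensorMap Φ Φ) where
  posSemidef M hM := by
    let swap := (reindexLinearEquiv ℂ ℂ (Equiv.prodComm (Fin d) (Fin d))
      (Equiv.prodComm (Fin d) (Fin d))).toLinearMap
    have hswap : ∀ A B : Matrix (Fin d) (Fin d) ℂ, swap (A ⊗ₖ B) = B ⊗ₖ A := by
      intro A B
      ext ⟨i, j⟩ ⟨k, l⟩
      simp [swap, mul_comm]
    have hps : ∀ N, N.PosSemidef → (swap N).PosSemidef := fun N hN => hN.submatrix _
    -- Complete positivity ancillates on the right only, so the factor swap lets `Φ ⊗ id` act on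
    -- each factor in turn.
    have heq : tensorMap Φ Φ =
        tensorMap Φ LinearMap.id ∘ₗ swap ∘ₗ tensorMap Φ LinearMap.id ∘ₗ swap :=
      kronecker_linearMap_ext fun A B => by simp [tensorMap_kronecker, hswap]
    rw [heq]
    exact hΦ.completely_positive d _ (hps _ (hΦ.completely_positive d _ (hps _ hM)))
  trace_preserving M := by
    have heq : traceLinearMap _ ℂ ℂ ∘ₗ tensorMap Φ Φ = traceLinearMap _ ℂ ℂ :=
      kronecker_linearMap_ext fun A B => by
        simp [tensorMap_kronecker, trace_kronecker, hΦ.trace_preserving]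
    exact LinearMap.congr_fun heq M

theorem kronecker_coe_mem_unitaryGroup (U : unitaryGroup α ℂ) (V : unitaryGroup γ ℂ) :
    (U : Matrix α α ℂ) ⊗ₖ (V : Matrix γ γ ℂ) ∈ unitaryGroup (α × γ) ℂ := by
  rw [mem_unitaryGroup_iff, star_eq_conjTranspose, conjTranspose_kronecker, ← mul_kronecker_mul,
    ← star_eq_conjTranspose, ← star_eq_conjTranspose, mem_unitaryGroup_iff.1 U.2,
    mem_unitaryGroup_iff.1 V.2, one_kronecker_one]

theorem conjDiagonal_kronecker (U : unitaryGroup α ℂ) (V : unitaryGroup γ ℂ) (a : α → ℝ)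
    (b : γ → ℝ) : conjDiagonal U a ⊗ₖ conjDiagonal V b =
      conjDiagonal ⟨_, kronecker_coe_mem_unitaryGroup U V⟩ fun p => a p.1 * b p.2 := by
  simp only [conjDiagonal_apply, star_eq_conjTranspose, conjTranspose_kronecker,
    mul_kronecker_mul, diagonal_kronecker_diagonal, Complex.ofReal_mul]

/-- The entropy is additive on tensor products of states. -/
theorem entropy_kronecker {ρ : Matrix α α ℂ} {σ : Matrix γ γ ℂ} (hρ : ρ.IsHermitian)
    (hσ : σ.IsHermitian) (hρ1 : ρ.trace = 1) (hσ1 : σ.trace = 1) :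
    entropy (ρ ⊗ₖ σ) = entropy ρ + entropy σ := by
  obtain ⟨U, r, rfl⟩ : ∃ (U : unitaryGroup α ℂ) (r : α → ℝ), conjDiagonal U r = ρ :=
    ⟨_, _, conjDiagonal_eigenvalues hρ⟩
  obtain ⟨V, s, rfl⟩ : ∃ (V : unitaryGroup γ ℂ) (s : γ → ℝ), conjDiagonal V s = σ :=
    ⟨_, _, conjDiagonal_eigenvalues hσ⟩
  have hr : ∑ i, r i = 1 := by rw [← re_trace_conjDiagonal U, hρ1, Complex.one_re]
  have hs : ∑ i, s i = 1 := by rw [← re_trace_conjDiagonal V, hσ1, Complex.one_re]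
  rw [conjDiagonal_kronecker]
  -- The product rule for `Real.negMulLog` also holds at zero eigenvalues, so singular states need
  -- no separate case.
  simp only [entropy_conjDiagonal, Fintype.sum_prod_type, Real.negMulLog_mul,
    Finset.sum_add_distrib, ← Finset.sum_mul, ← Finset.mul_sum, hr, hs, one_mul]

theorem proj_kronecker (ψ : α → ℂ) (φ : γ → ℂ) :
    proj (fun p : α × γ => ψ p.1 * φ p.2) = proj ψ ⊗ₖ proj φ := by
  ext ⟨i, j⟩ ⟨k, l⟩
  simp [proj, vecMulVec_apply, mul_mul_mul_comm]

/-- The product of two ensembles. -/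
def PureEnsemble.prod (E : PureEnsemble α) (F : PureEnsemble γ) : PureEnsemble (α × γ) :=
  ofFintype (ι := Fin E.size × Fin F.size) (fun i => E.weight i.1 * F.weight i.2)
    (fun i p => E.vec i.1 p.1 * F.vec i.2 p.2)
    (fun i => mul_nonneg (E.weight_nonneg _) (F.weight_nonneg _))
    (by simp [Fintype.sum_prod_type, ← Finset.mul_sum, F.weight_sum, E.weight_sum])
    (fun i => by
      have h : star (E.vec i.1) ⬝ᵥ E.vec i.1 * (star (F.vec i.2) ⬝ᵥ F.vec i.2) = 1 := by
        rw [E.vec_unit, F.vec_unit, one_mul]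
      rw [← h]
      simp only [dotProduct, Fintype.sum_prod_type, Finset.sum_mul_sum, Pi.star_apply, star_mul']
      exact Finset.sum_congr rfl fun _ _ => Finset.sum_congr rfl fun _ _ => by ring)

theorem sum_smul_proj_kronecker (E : PureEnsemble α) (F : PureEnsemble γ) :
    ∑ i : Fin E.size × Fin F.size, ((E.weight i.1 * F.weight i.2 : ℝ) : ℂ) •
      proj (fun p : α × γ => E.vec i.1 p.1 * F.vec i.2 p.2) = E.average ⊗ₖ F.average := by
  ext ⟨i, j⟩ ⟨k, l⟩
  simp only [proj_kronecker, PureEnsemble.average, kronecker_apply, Matrix.sum_apply,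
    Matrix.smul_apply,
    Finset.sum_mul_sum, Fintype.sum_prod_type, smul_eq_mul, Complex.ofReal_mul]
  exact Finset.sum_congr rfl fun _ _ => Finset.sum_congr rfl fun _ _ => by ring

theorem PureEnsemble.average_prod (E : PureEnsemble α) (F : PureEnsemble γ) :
    (E.prod F).average = E.average ⊗ₖ F.average := by
  rw [prod, average_ofFintype, sum_smul_proj_kronecker]

theorem holevoChi_prod {Φ : Matrix α α ℂ →ₗ[ℂ] Matrix β β ℂ}
    {Ψ : Matrix γ γ ℂ →ₗ[ℂ] Matrix δ δ ℂ} (hΦ : IsPositiveTP Φ) (hΨ : IsPositiveTP Ψ)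
    (E : PureEnsemble α) (F : PureEnsemble γ) :
    holevoChi (tensorMap Φ Ψ) (E.prod F) = holevoChi Φ E + holevoChi Ψ F := by
  have hadd : ∀ {ρ : Matrix α α ℂ} {σ : Matrix γ γ ℂ}, ρ.PosSemidef → σ.PosSemidef →
      ρ.trace = 1 → σ.trace = 1 →
      entropy (tensorMap Φ Ψ (ρ ⊗ₖ σ)) = entropy (Φ ρ) + entropy (Ψ σ) := by
    intro ρ σ hρ hσ hρ1 hσ1
    rw [tensorMap_kronecker]
    exact entropy_kronecker (hΦ.posSemidef _ hρ).1 (hΨ.posSemidef _ hσ).1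
      (by rw [hΦ.trace_preserving, hρ1]) (by rw [hΨ.trace_preserving, hσ1])
  rw [PureEnsemble.prod, holevoChi_ofFintype, sum_smul_proj_kronecker,
    hadd E.posSemidef_average F.posSemidef_average E.trace_average F.trace_average]
  have hterm : ∀ i : Fin E.size × Fin F.size, E.weight i.1 * F.weight i.2 *
      entropy (tensorMap Φ Ψ (proj fun p => E.vec i.1 p.1 * F.vec i.2 p.2)) =
      E.weight i.1 * entropy (Φ (proj (E.vec i.1))) * F.weight i.2 +
        E.weight i.1 * (F.weight i.2 * entropy (Ψ (proj (F.vec i.2)))) := by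
    intro i
    rw [proj_kronecker, hadd (posSemidef_proj _) (posSemidef_proj _) (trace_proj (E.vec_unit _))
      (trace_proj (F.vec_unit _))]
    ring
  simp only [hterm, Fintype.sum_prod_type, Finset.sum_add_distrib, ← Finset.mul_sum,
    ← Finset.sum_mul, E.weight_sum, F.weight_sum, mul_one, one_mul, holevoChi]
  ring

end TensorProduct

end

end QuantumChannel

/-! ### The criterion for superadditivity. -/

open QuantumChannel in
theorem theorem10 (d : ℕ) (hd : 1 ≤ d)
    (Φ : Matrix (Fin d) (Fin d) ℂ →ₗ[ℂ] Matrix (Fin d) (Fin d) ℂ) (hΦ : IsChannel Φ) :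
    (∃ ρAv : Matrix (Fin d) (Fin d) ℂ, IsOptimalAverageInput Φ ρAv) ∧
    ∀ ρAv : Matrix (Fin d) (Fin d) ℂ, IsOptimalAverageInput Φ ρAv →
      (2 * holevoCapacity Φ < holevoCapacity (tensorMap Φ Φ) ↔
        ∃ Ψ : Fin d × Fin d → ℂ, star Ψ ⬝ᵥ Ψ = 1 ∧
          2 * holevoCapacity Φ <
            relEntropy (tensorMap Φ Φ (proj Ψ)) (tensorMap Φ Φ (ρAv ⊗ₖ ρAv))) := by
  have hpos := hΦ.isPositiveTP
  have hposT := hΦ.tensorMap_self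
  constructor
  -- For `d = 0` there would be no unit vector and hence no ensemble.
  · have : Nonempty (Fin d) := ⟨⟨0, hd⟩⟩
    obtain ⟨E, hE⟩ := exists_isMax_holevoChi hpos
    exact ⟨_, E, holevoCapacity_eq_of_isMax hE, rfl⟩
  rintro _ ⟨E, hE, rfl⟩
  have hprod : ((holevoChi (tensorMap Φ Φ) (E.prod E) : ℝ) : EReal) = 2 * holevoCapacity Φ := by
    rw [holevoChi_prod hpos hpos, ← hE, ← two_mul]
    norm_cast
  rw [← E.average_prod]
  constructor
  · intro h
    obtain ⟨F, hF⟩ := lt_iSup_iff.1 h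
    obtain ⟨j, hj⟩ := exists_holevoChi_le_relEntropy hposT F
      (hposT.posSemidef _ (E.prod E).posSemidef_average)
      (by rw [hposT.trace_preserving, PureEnsemble.trace_average])
    exact ⟨F.vec j, F.vec_unit j, hF.trans_le hj⟩
  · rintro ⟨Ψ, hΨ, h⟩
    -- Without superadditivity `E.prod E` attains the capacity of `Φ ⊗ Φ`, so every pure output lies
    -- within `2C` of its average output.
    by_contra! hle
    rw [← hprod] at h hle
    refine (relEntropy_le_of_isMax hposT (fun F => ?_) hΨ).not_gt h
    exact_mod_cast (le_iSup (fun F => (holevoChi (tensorMap Φ Φ) F : EReal)) F).trans hle
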